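/- Let $n\ge 1$ be an integer. For a preadditive category $\mathcal M$, a sequence $X^0\xrightarrow{d^0}X^1\to\cdots\xrightarrow{d^n}X^{n+1}$ in $\mathcal M$ is called right $n$-exact (and $(d^1,\dots,d^n)$ an $n$-cokernel of $d^0$) if for every $Y\in\mathcal M$ the sequence of abelian groups $$0\to\mathcal M(X^{n+1},Y)\to\mathcal M(X^n,Y)\to\cdots\to\mathcal M(X^1,Y)\to\mathcal M(X^0,Y)$$ is exact; left $n$-exact sequences and $n$-kernels are defined dually, and a sequence is $n$-exact if it is both left and right $n$-exact. Let $\mathcal M$ be a small $n$-abelian category, that is, a small additive category such that: (A0) $\mathcal M$ is idempotent complete; (A1) every morphism of $\mathcal M$ has an $n$-kernel and an $n$-cokernel; (A2) every right $n$-exact sequence whose first morphism $d^0$ is a monomorphism is $n$-exact; (A3) every left $n$-exact sequence whose last morphism $d^n$ is an epimorphism is $n$-exact. A mono functor is an additive functor $F:\mathcal M\to\mathrm{Ab}$ that preserves monomorphisms. A mono functor $F$ is absolutely pure if, whenever $F$ is a subfunctor of a mono functor $N$, the quotient $N/F$ is a mono functor. Let $L_2(\mathcal M,\mathrm{Ab})$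 be the full subcategory, of the category of additive functors $\mathcal M\to\mathrm{Ab}$, whose objects are the absolutely pure functors. Then $L_2(\mathcal M,\mathrm{Ab})$ is an abelian category; for every $X\in\mathcal M$ the functor $\mathcal M(X,-)$ is absolutely pure; and the resulting contravariant functor $\widetilde H:\mathcal M\to L_2(\mathcal M,\mathrm{Ab})$, $X\mapsto\mathcal M(X,-)$, is $n$-exact: for every $n$-exact sequence $X^0\to X^1\to\cdots\to X^{n+1}$ in $\mathcal M$ the sequence $$0\to\mathcal M(X^{n+1},-)\to\mathcal M(X^n,-)\to\cdots\to\mathcal M(X^1,-)\to\mathcal M(X^0,-)\to 0$$ is exact in $L_2(\mathcal M,\mathrm{Ab})$. -/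

import Mathlib

open CategoryTheory CategoryTheory.Limits Opposite

universe v u v' u'

namespace NAb

section Sequences

variable {C : Type u} [Category.{v} C] [Preadditive C]

/-- A sequence `X⁰ ⟶ X¹ ⟶ ⋯ ⟶ Xⁿ⁺¹` is right `n`-exact if `(d¹, …, dⁿ)` is an `n`-cokernel of `d⁰`:
for every object `Y` the induced sequence of abelian groups
`0 ⟶ C(Xⁿ⁺¹, Y) ⟶ C(Xⁿ, Y) ⟶ ⋯ ⟶ C(X¹, Y) ⟶ C(X⁰, Y)` is exact. -/
structure IsRightNExact (n : ℕ) (X : ComposableArrows C (n + 1)) : Prop where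
  /-- exactness at `C(Xⁿ⁺¹, Y)` -/
  injective (Y : C) :
    Function.Injective (fun u : X.obj' (n + 1) ⟶ Y => X.map' n (n + 1) ≫ u)
  /-- exactness at `C(Xᵏ⁺¹, Y)`, for `1 ≤ k + 1 ≤ n` -/
  exact (Y : C) (k : ℕ) (hk : k < n) :
    Function.Exact (fun u : X.obj' (k + 2) ⟶ Y => X.map' (k + 1) (k + 2) ≫ u)
      (fun u : X.obj' (k + 1) ⟶ Y => X.map' k (k + 1) ≫ u)

/-- A sequence `X⁰ ⟶ X¹ ⟶ ⋯ ⟶ Xⁿ⁺¹` is left `n`-exact if `(d⁰, …, dⁿ⁻¹)` is an `n`-kernel of `dⁿ`: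
for every object `Y` the induced sequence of abelian groups
`0 ⟶ C(Y, X⁰) ⟶ C(Y, X¹) ⟶ ⋯ ⟶ C(Y, Xⁿ) ⟶ C(Y, Xⁿ⁺¹)` is exact. -/
structure IsLeftNExact (n : ℕ) (X : ComposableArrows C (n + 1)) : Prop where
  /-- exactness at `C(Y, X⁰)` -/
  injective (Y : C) :
    Function.Injective (fun u : Y ⟶ X.obj' 0 => u ≫ X.map' 0 1)
  /-- exactness at `C(Y, Xᵏ⁺¹)`, for `1 ≤ k + 1 ≤ n` -/
  exact (Y : C) (k : ℕ) (hk : k < n) :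
    Function.Exact (fun u : Y ⟶ X.obj' k => u ≫ X.map' k (k + 1))
      (fun u : Y ⟶ X.obj' (k + 1) => u ≫ X.map' (k + 1) (k + 2))

/-- An `n`-exact sequence is one which is both left and right `n`-exact. -/
structure IsNExactSeq (n : ℕ) (X : ComposableArrows C (n + 1)) : Prop where
  left : IsLeftNExact n X
  right : IsRightNExact n X

end Sequences

/-- The preadditive category `C` is an `n`-abelian category (to be used for `n ≥ 1`). -/
structure IsNAbelian (n : ℕ) (C : Type u) [Category.{v} C] [Preadditive C] : Prop where
  /-- `C` is additive. -/
  hasFiniteBiproducts : HasFiniteBiproducts C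
  /-- (A0) `C` is idempotent complete. -/
  isIdempotentComplete : IsIdempotentComplete C
  /-- (A1) Every morphism has an `n`-kernel. -/
  exists_nKernel {A B : C} (f : A ⟶ B) :
    ∃ X : ComposableArrows C (n + 1), Arrow.mk (X.map' n (n + 1)) = Arrow.mk f ∧ IsLeftNExact n X
  /-- (A1) Every morphism has an `n`-cokernel. -/
  exists_nCokernel {A B : C} (f : A ⟶ B) :
    ∃ X : ComposableArrows C (n + 1), Arrow.mk (X.map' 0 1) = Arrow.mk f ∧ IsRightNExact n X
  /-- (A2) A monomorphism followed by any of its `n`-cokernels is `n`-exact. -/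
  nExact_of_mono (X : ComposableArrows C (n + 1)) :
    Mono (X.map' 0 1) → IsRightNExact n X → IsNExactSeq n X
  /-- (A3) An epimorphism preceded by any of its `n`-kernels is `n`-exact. -/
  nExact_of_epi (X : ComposableArrows C (n + 1)) :
    Epi (X.map' n (n + 1)) → IsLeftNExact n X → IsNExactSeq n X

/-- A contravariant functor `F` from `C` to `A` (an abelian category in practice) is `n`-exact if for
each `n`-exact sequence `X⁰ ⟶ ⋯ ⟶ Xⁿ⁺¹` in `C` the sequence
`0 ⟶ F Xⁿ⁺¹ ⟶ F Xⁿ ⟶ ⋯ ⟶ F X¹ ⟶ F X⁰ ⟶ 0` is exact in `A`. -/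
structure IsContravariantNExact (n : ℕ) {C : Type u} [Category.{v} C] [Preadditive C]
    {A : Type u'} [Category.{v'} A] [HasZeroMorphisms A] (F : Cᵒᵖ ⥤ A) : Prop where
  /-- exactness at `F Xⁿ⁺¹` -/
  mono (X : ComposableArrows C (n + 1)) (hX : IsNExactSeq n X) :
    Mono (F.map (X.map' n (n + 1)).op)
  /-- exactness at `F Xᵏ⁺¹`, for `1 ≤ k + 1 ≤ n` -/
  exact (X : ComposableArrows C (n + 1)) (hX : IsNExactSeq n X) (k : ℕ) (hk : k < n) :
    ∃ w : F.map (X.map' (k + 1) (k + 2)).op ≫ F.map (X.map' k (k + 1)).op = 0,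
      (ShortComplex.mk _ _ w).Exact
  /-- exactness at `F X⁰` -/
  epi (X : ComposableArrows C (n + 1)) (hX : IsNExactSeq n X) :
    Epi (F.map (X.map' 0 1).op)

section Functors

variable {M : Type u} [SmallCategory M] [Preadditive M]

/-- A mono functor: an additive functor to abelian groups that preserves monomorphisms. -/
structure IsMonoFunctor (F : M ⥤ AddCommGrpCat.{u}) : Prop where
  additive : F.Additive
  preservesMonomorphisms : F.PreservesMonomorphisms

/-- An absolutely pure functor: a mono functor such that, whenever it is (isomorphic to) a subfunctor
of a mono functor `N`, the quotient functor of `N` by it is again a mono functor. Monomorphisms and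
cokernels of functors to abelian groups are computed objectwise. -/
structure IsAbsolutelyPure (F : M ⥤ AddCommGrpCat.{u}) : Prop where
  isMonoFunctor : IsMonoFunctor F
  isMonoFunctor_cokernel (N : M ⥤ AddCommGrpCat.{u}) (hN : IsMonoFunctor N) (i : F ⟶ N) [Mono i] :
    IsMonoFunctor (cokernel i)

variable (M) in
/-- The property of functors `M ⥤ AddCommGrpCat` of being absolutely pure. -/
def absolutelyPure : ObjectProperty (M ⥤ AddCommGrpCat.{u}) :=
  fun F => IsAbsolutelyPure F

variable (M) in
/-- `L₂(M, Ab)`: the full subcategory of absolutely pure functors. -/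
abbrev L2 := (absolutelyPure M).FullSubcategory

/-- The functor `X ↦ M(X, -)` from `Mᵒᵖ` to `L₂(M, Ab)`, given that representable functors are
absolutely pure. -/
def representation (h : ∀ X : Mᵒᵖ, absolutelyPure M (preadditiveCoyoneda.obj X)) : Mᵒᵖ ⥤ L2 M :=
  (absolutelyPure M).lift preadditiveCoyoneda h

end Functors

end NAb

/-! The sieves containing a monomorphism of `M` form a Grothendieck topology on `Mᵒᵖ`, and the
absolutely pure functors are exactly the additive sheaves for it (`isAbsolutelyPure_of_isSheaf`,
`isSheaf_of_isAbsolutelyPure`). Among all abelian sheaves these are closed under subobjects,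
quotients and finite products, hence form an abelian category. Axiom (A2) enters through
`exists_mono_weakKernel`: every monomorphism is a weak kernel. This yields the amalgamation needed
for the topology and the sheaf property of representables. Exactness of `X ↦ M(X, -)` is then
objectwise, except at the right end, where injectivity of `F.map f` for `f` mono gives an
epimorphism. -/

namespace NAb

/-! ### Monomorphisms in an `n`-abelian category -/

section NAbelian

variable {C : Type u} [Category.{v} C]

variable (C) in
/-- Spans with a monomorphic leg can be completed to commutative squares in which the opposite
leg is again a monomorphism. -/
def HasMonoAmalgamation : Prop :=
  ∀ ⦃X Y Z : C⦄ (f : X ⟶ Y) (g : X ⟶ Z), Mono f →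
    ∃ (W : C) (h : Y ⟶ W) (k : Z ⟶ W), Mono k ∧ f ≫ h = g ≫ k

variable [Preadditive C] {n : ℕ}

/-- By (A2) an `n`-cokernel sequence of `f` is also left `n`-exact; its exactness at `X¹`, available
since `1 ≤ n`, is the claim. -/
lemma IsNAbelian.exists_mono_weakKernel (hn : 1 ≤ n) (hC : IsNAbelian n C) {A B : C} (f : A ⟶ B)
    [Mono f] :
    ∃ (D : C) (c : B ⟶ D), f ≫ c = 0 ∧ ∀ ⦃T : C⦄ (t : T ⟶ B), t ≫ c = 0 → ∃ s, s ≫ f = t := by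
  obtain ⟨X, hXf, hX⟩ := hC.exists_nCokernel f
  -- Quantifying over arrows lets the equality of arrows be eliminated without transport.
  suffices H : ∀ a : Arrow C, Mono a.hom → Arrow.mk (X.map' 0 1) = a →
      ∃ (D : C) (c : a.right ⟶ D), a.hom ≫ c = 0 ∧
        ∀ ⦃T : C⦄ (t : T ⟶ a.right), t ≫ c = 0 → ∃ s, s ≫ a.hom = t from
    H (Arrow.mk f) ‹_› hXf
  rintro _ hm rfl
  have hl := (hC.nExact_of_mono X hm hX).left
  refine ⟨_, X.map' 1 2, ?_, fun T t ht => ?_⟩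
  · simpa using (hl.exact _ 0 hn (X.map' 0 1)).2 ⟨𝟙 _, by simp⟩
  · obtain ⟨s, hs⟩ := (hl.exact T 0 hn t).1 ht
    exact ⟨s, hs⟩

/-- A substitute for the pushout: the two components of a map of which `(f, g) : X ⟶ Y ⊞ Z` is a
weak kernel, one of them negated. If `z` is killed by the leg out of `Z`, then `(0, z)` factors
through `(f, g)` by some `s` with `s ≫ f = 0`, so `s = 0` and `z = 0`. -/
lemma IsNAbelian.hasMonoAmalgamation (hn : 1 ≤ n) (hC : IsNAbelian n C) :
    HasMonoAmalgamation C := by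
  intro X Y Z f g hf
  have := hC.hasFiniteBiproducts
  have : HasBinaryBiproducts C := hasBinaryBiproducts_of_finite_biproducts C
  have : Mono (biprod.lift f g) := by
    have : Mono (biprod.lift f g ≫ biprod.fst) := by simpa using hf
    exact mono_of_mono _ biprod.fst
  obtain ⟨W, c, hc, hk⟩ := hC.exists_mono_weakKernel hn (biprod.lift f g)
  refine ⟨W, biprod.inl ≫ c, -(biprod.inr ≫ c), ?_, ?_⟩
  · refine Preadditive.mono_of_cancel_zero _ fun {T} z hz => ?_
    obtain ⟨s, hs⟩ := hk (z ≫ biprod.inr) (by simpa using hz)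
    have h₁ : s ≫ f = 0 := by simpa using congr($hs ≫ biprod.fst)
    have h₂ : s ≫ g = z := by simpa using congr($hs ≫ biprod.snd)
    rw [← h₂, zero_of_comp_mono f h₁, zero_comp]
  · rw [Preadditive.comp_neg, ← sub_eq_zero, sub_neg_eq_add, ← hc, biprod.lift_eq]
    simp

end NAbelian

/-! ### The topology of monomorphisms and its sheaves -/

section Topology

variable {C : Type u} [Category.{v} C]

/-- The topology on `Cᵒᵖ` whose covering sieves are those containing a monomorphism of `C`. -/
def monoTopology (hC : HasMonoAmalgamation C) : GrothendieckTopology Cᵒᵖ where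
  sieves X := {S | ∃ (Y : C) (f : X.unop ⟶ Y), Mono f ∧ S f.op}
  top_mem' X := ⟨_, 𝟙 _, inferInstance, trivial⟩
  pullback_stable' := by
    rintro X Y S g ⟨Z, f, hf, hS⟩
    obtain ⟨W, h, k, hk, w⟩ := hC f g.unop hf
    refine ⟨W, k, hk, ?_⟩
    have : k.op ≫ g = h.op ≫ f.op := Quiver.Hom.unop_inj w.symm
    simpa [Sieve.pullback_apply, this] using S.downward_closed hS h.op
  transitive' := by
    rintro X S ⟨Y, f, hf, hS⟩ R hR
    obtain ⟨Z, g, hg, hgR⟩ := hR hS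
    exact ⟨Z, f ≫ g, mono_comp _ _, hgR⟩

end Topology

section Sheaves

variable {M : Type u} [SmallCategory M] (hC : HasMonoAmalgamation M)

/-- A covariant functor regarded as a presheaf on the opposite category. -/
abbrev toPresheaf (F : M ⥤ AddCommGrpCat.{u}) : Mᵒᵖᵒᵖ ⥤ AddCommGrpCat.{u} := unopUnop M ⋙ F

lemma isSheaf_toPresheaf_iff (F : M ⥤ AddCommGrpCat.{u}) :
    Presheaf.IsSheaf (monoTopology hC) (toPresheaf F) ↔
      ∀ ⦃X Y : M⦄ (f : X ⟶ Y), Mono f → Function.Injective (F.map f) ∧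
        ∀ y : F.obj Y, (∀ ⦃Z : M⦄ (a b : Y ⟶ Z), f ≫ a = f ≫ b → F.map a y = F.map b y) →
          ∃ x : F.obj X, F.map f x = y := by
  rw [Presheaf.isSheaf_iff_isSheaf_forget (s := forget AddCommGrpCat.{u}),
    isSheaf_iff_isSheaf_of_type]
  constructor
  · intro hF X Y f hf
    have hS := hF (Sieve.generate (Presieve.singleton f.op))
      ⟨Y, f, hf, Sieve.le_generate (Presieve.singleton f.op) _ _ (Presieve.singleton_self _)⟩
    rw [← Presieve.isSheafFor_iff_generate, Presieve.isSheafFor_singleton] at hS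
    refine ⟨fun x x' h => ?_, fun y hy => ?_⟩
    · obtain ⟨z, -, hz⟩ := hS (F.map f x) fun {Z} p₁ p₂ hp => by
        have := congr(F.map $(congr_arg Quiver.Hom.unop hp) x)
        simpa using! this
      exact (hz x rfl).trans (hz x' h.symm).symm
    · obtain ⟨x, hx, -⟩ := hS y fun {Z} p₁ p₂ hp =>
        hy p₁.unop p₂.unop (congr_arg Quiver.Hom.unop hp)
      exact ⟨x, hx⟩
  · rintro hF ⟨X⟩ S ⟨Y, f, hf, hS⟩ x hx
    obtain ⟨t, ht⟩ := (hF f hf).2 (x f.op hS) fun Z a b hab =>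
      hx a.op b.op hS hS (Quiver.Hom.unop_inj hab)
    refine ⟨t, ?_, ?_⟩
    · rintro ⟨Z⟩ g hg
      -- The section over `g` is compared with the restriction of `t` after the monomorphism `k`,
      -- where both come from the section over `f`.
      obtain ⟨W, h, k, hk, w⟩ := hC f g.unop hf
      have h₁ : x (h.op ≫ f.op) (S.downward_closed hS _) = F.map h (x f.op hS) :=
        Presieve.FamilyOfElements.comp_of_compatible _ hx _ _
      have h₂ : x (k.op ≫ g) (S.downward_closed hg _) = F.map k (x g hg) :=
        Presieve.FamilyOfElements.comp_of_compatible _ hx _ _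
      apply (hF k hk).1
      have h₃ : h.op ≫ f.op = k.op ≫ g := Quiver.Hom.unop_inj w
      have h₄ : F.map h (F.map f t) = F.map k (F.map g.unop t) := by
        simpa using congr(F.map $w t)
      refine h₄.symm.trans ((congr_arg (F.map h) ht).trans (h₁.symm.trans (Eq.trans ?_ h₂)))
      congr 1
    · intro t' ht'
      exact (hF f hf).1 ((ht' _ hS).trans ht.symm)

end Sheaves

/-! ### Additivity, and purity of sheaves -/

section Functors

variable {M : Type u} [SmallCategory M]

lemma preservesMonomorphisms_iff (F : M ⥤ AddCommGrpCat.{u}) :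
    F.PreservesMonomorphisms ↔
      ∀ ⦃X Y : M⦄ (f : X ⟶ Y), Mono f → Function.Injective (F.map f) := by
  constructor
  · intro _ X Y f _
    exact (AddCommGrpCat.mono_iff_injective _).1 inferInstance
  · intro h
    exact ⟨fun f hf => (AddCommGrpCat.mono_iff_injective _).2 (h f hf)⟩

lemma injective_app {F G : M ⥤ AddCommGrpCat.{u}} (i : F ⟶ G) [Mono i] (X : M) :
    Function.Injective (i.app X) :=
  (AddCommGrpCat.mono_iff_injective _).1 inferInstance

lemma cokernel_π_app_surjective {F G : M ⥤ AddCommGrpCat.{u}} (i : F ⟶ G) (X : M) :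
    Function.Surjective ((cokernel.π i).app X) :=
  (AddCommGrpCat.epi_iff_surjective _).1 inferInstance

lemma cokernel_π_app_eq_zero_iff {F G : M ⥤ AddCommGrpCat.{u}} (i : F ⟶ G) (X : M)
    (x : G.obj X) : (cokernel.π i).app X x = 0 ↔ ∃ y, i.app X y = x := by
  have h := (ShortComplex.cokernelSequence_exact i).map ((evaluation _ _).obj X)
  rw [ShortComplex.ab_exact_iff_function_exact] at h
  exact h x

variable [Preadditive M]

lemma additive_of_injective {F G : M ⥤ AddCommGrpCat.{u}} (i : F ⟶ G)
    (hi : ∀ X, Function.Injective (i.app X)) (hG : G.Additive) : F.Additive where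
  map_add {X Y a b} := by
    ext x
    apply hi Y
    have h (c : X ⟶ Y) : i.app Y (F.map c x) = G.map c (i.app X x) := NatTrans.naturality_apply i c x
    simp [h, hG.map_add]

/-- If every section of a functor preserving monomorphisms comes, after restriction along a
monomorphism, from an additive functor, then that functor is additive. -/
lemma additive_of_locallySurjective (hC : HasMonoAmalgamation M) {F G : M ⥤ AddCommGrpCat.{u}}
    (q : F ⟶ G) (hF : F.Additive) (hG : G.PreservesMonomorphisms)
    (hq : ∀ (X : M) (s : G.obj X), ∃ (Y : M) (f : X ⟶ Y) (t : F.obj Y),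
      Mono f ∧ q.app Y t = G.map f s) : G.Additive where
  map_add {X Y a b} := by
    ext s
    obtain ⟨X', f, t, hf, ht⟩ := hq X s
    -- Amalgamating twice gives one monomorphism `g₁ ≫ g₂` after which both `a` and `b` extend along
    -- `f`.
    obtain ⟨Y₁, a₁, g₁, hg₁, w₁⟩ := hC f a hf
    obtain ⟨Y₂, b₂, g₂, hg₂, w₂⟩ := hC f (b ≫ g₁) hf
    have w₃ : f ≫ (a₁ ≫ g₂) = a ≫ g₁ ≫ g₂ := by simp [reassoc_of% w₁]
    apply (preservesMonomorphisms_iff G).1 hG (g₁ ≫ g₂) (mono_comp _ _)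
    have h {c : X ⟶ Y} {d : X' ⟶ Y₂} (w : f ≫ d = c ≫ g₁ ≫ g₂) :
        G.map (g₁ ≫ g₂) (G.map c s) = q.app Y₂ (F.map d t) := by
      rw [NatTrans.naturality_apply, ht, ← ConcreteCategory.comp_apply,
        ← ConcreteCategory.comp_apply, ← G.map_comp, ← G.map_comp, w]
    rw [h (d := a₁ ≫ g₂ + b₂) (by simp [w₂, reassoc_of% w₁])]
    simp only [AddCommGrpCat.hom_add, AddMonoidHom.add_apply, map_add, hF.map_add]
    rw [h w₃, h (by simpa using w₂)]

lemma additive_of_surjective {F G : M ⥤ AddCommGrpCat.{u}} (q : F ⟶ G)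
    (hq : ∀ X, Function.Surjective (q.app X)) (hF : F.Additive) : G.Additive where
  map_add {X Y a b} := by
    ext x
    obtain ⟨x, rfl⟩ := hq X x
    have h (c : X ⟶ Y) : G.map c (q.app X x) = q.app Y (F.map c x) :=
      (NatTrans.naturality_apply q c x).symm
    simp only [h, hF.map_add, AddCommGrpCat.hom_add, AddMonoidHom.add_apply, map_add]

variable (hC : HasMonoAmalgamation M)

lemma isAbsolutelyPure_of_isSheaf (F : M ⥤ AddCommGrpCat.{u}) (hF : F.Additive)
    (hF' : Presheaf.IsSheaf (monoTopology hC) (toPresheaf F)) : IsAbsolutelyPure F := by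
  rw [isSheaf_toPresheaf_iff] at hF'
  refine ⟨⟨hF, (preservesMonomorphisms_iff F).2 fun X Y f hf => (hF' f hf).1⟩, ?_⟩
  intro N hN i _
  refine ⟨additive_of_surjective (cokernel.π i) (cokernel_π_app_surjective i) hN.additive, ?_⟩
  refine (preservesMonomorphisms_iff _).2 fun X Y f hf => ?_
  have hNm := (preservesMonomorphisms_iff N).1 hN.preservesMonomorphisms
  rw [injective_iff_map_eq_zero]
  intro s hs
  obtain ⟨s, rfl⟩ := cokernel_π_app_surjective i X s
  rw [← NatTrans.naturality_apply, cokernel_π_app_eq_zero_iff] at hs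
  obtain ⟨t, ht⟩ := hs
  -- The lift `t` satisfies the descent condition because its image in `N` comes from `s` along `f`.
  obtain ⟨r, rfl⟩ := (hF' f hf).2 t fun Z a b hab => by
    apply injective_app i
    rw [NatTrans.naturality_apply, NatTrans.naturality_apply, ht, ← ConcreteCategory.comp_apply,
      ← ConcreteCategory.comp_apply, ← N.map_comp, ← N.map_comp, hab]
  rw [cokernel_π_app_eq_zero_iff]
  refine ⟨r, hNm f hf ?_⟩
  rw [← ht, NatTrans.naturality_apply]

end Functors

/-! ### Absolutely pure functors as additive sheaves -/

section Sheaves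

variable {M : Type u} [SmallCategory M] [Preadditive M] (hC : HasMonoAmalgamation M)

/-- Purity is tested on the embedding of `F` into its sheafification `G`. Sections of `G` lie in `F`
after some monomorphism, so their classes in the mono functor `G/F` vanish and `F = G`. -/
lemma isSheaf_of_isAbsolutelyPure (F : M ⥤ AddCommGrpCat.{u}) (hF : IsAbsolutelyPure F) :
    Presheaf.IsSheaf (monoTopology hC) (toPresheaf F) := by
  let J := monoTopology hC
  let G : M ⥤ AddCommGrpCat.{u} := opOp M ⋙ sheafify J (toPresheaf F)
  let i : F ⟶ G := Functor.whiskerLeft (opOp M) (toSheafify J (toPresheaf F))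
  have hFm := (preservesMonomorphisms_iff F).1 hF.isMonoFunctor.preservesMonomorphisms
  have hG : Presheaf.IsSheaf J (toPresheaf G) := ((presheafToSheaf J _).obj (toPresheaf F)).property
  have hGm := (preservesMonomorphisms_iff G).2 fun X Y f hf =>
    ((isSheaf_toPresheaf_iff hC G).1 hG f hf).1
  have hi_inj (X : M) : Function.Injective (i.app X) := by
    intro x y hxy
    obtain ⟨Y, f, hf, h⟩ := Presheaf.equalizerSieve_mem J (toSheafify J (toPresheaf F))
      (X := op (op X)) x y hxy
    exact hFm f hf h
  have hi_surj (X : M) (s : G.obj X) : ∃ (Y : M) (f : X ⟶ Y) (t : F.obj Y),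
      Mono f ∧ i.app Y t = G.map f s := by
    obtain ⟨Y, f, hf, t, ht⟩ := Presheaf.imageSieve_mem J (toSheafify J (toPresheaf F))
      (U := op (op X)) s
    exact ⟨Y, f, t, hf, ht⟩
  have : Mono i := by
    have (X : M) : Mono (i.app X) := (AddCommGrpCat.mono_iff_injective _).2 (hi_inj X)
    exact NatTrans.mono_of_mono_app i
  have hQ := hF.isMonoFunctor_cokernel G
    ⟨additive_of_locallySurjective hC i hF.isMonoFunctor.additive hGm hi_surj, hGm⟩ i
  have (X : M) : IsIso (i.app X) := by
    refine (ConcreteCategory.isIso_iff_bijective _).2 ⟨hi_inj X, fun s => ?_⟩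
    obtain ⟨Y, f, t, hf, ht⟩ := hi_surj X s
    rw [← cokernel_π_app_eq_zero_iff]
    apply (preservesMonomorphisms_iff _).1 hQ.preservesMonomorphisms f hf
    rw [← NatTrans.naturality_apply, map_zero, cokernel_π_app_eq_zero_iff]
    exact ⟨t, ht⟩
  have : IsIso i := NatIso.isIso_of_isIso_app i
  exact (Presheaf.isSheaf_of_iso_iff (Functor.isoWhiskerLeft (unopUnop M) (asIso i))).2 hG

lemma isAbsolutelyPure_preadditiveCoyoneda (hC : HasMonoAmalgamation M)
    (hk : ∀ ⦃A B : M⦄ (f : A ⟶ B), Mono f →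
      ∃ (D : M) (c : B ⟶ D), f ≫ c = 0 ∧ ∀ ⦃T : M⦄ (t : T ⟶ B), t ≫ c = 0 → ∃ s, s ≫ f = t)
    (X : Mᵒᵖ) : IsAbsolutelyPure (preadditiveCoyoneda.obj X) := by
  refine isAbsolutelyPure_of_isSheaf hC _ inferInstance ((isSheaf_toPresheaf_iff hC _).2 ?_)
  intro A B f hf
  refine ⟨fun s t h => (cancel_mono f).1 h, fun y hy => ?_⟩
  obtain ⟨D, c, hc, hs⟩ := hk f hf
  exact hs y (by simpa using! hy c 0 (by simp [hc]))

/-- The additive sheaves for the topology given by the monomorphisms. -/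
def additiveSheaves : ObjectProperty (Sheaf (monoTopology hC) AddCommGrpCat.{u}) :=
  fun F => (opOp M ⋙ F.obj).Additive

instance : (additiveSheaves hC).IsClosedUnderSubobjects where
  prop_of_mono {F G} f _ hG :=
    additive_of_injective (Functor.whiskerLeft (opOp M) f.hom) (fun X => by
      have : Mono ((sheafToPresheaf _ _ ⋙ (evaluation _ _).obj (op (op X))).map f) := inferInstance
      exact (AddCommGrpCat.mono_iff_injective _).1 this) hG

instance : (additiveSheaves hC).IsClosedUnderQuotients where
  prop_of_epi {F G} f _ hF := by
    -- Epimorphisms of sheaves are only locally surjective, so additivity must be descended along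
    -- monomorphisms.
    have hl : Sheaf.IsLocallySurjective f := (Sheaf.isLocallySurjective_iff_epi' _ f).2 inferInstance
    refine additive_of_locallySurjective hC (Functor.whiskerLeft (opOp M) f.hom) hF
      ((preservesMonomorphisms_iff _).2 fun X Y f hf =>
        ((isSheaf_toPresheaf_iff hC (opOp M ⋙ G.obj)).1 G.property f hf).1) fun X s => ?_
    obtain ⟨Y, f, hf, t, ht⟩ := Presheaf.imageSieve_mem (monoTopology hC) f.hom (U := op (op X)) s
    exact ⟨Y, f, t, hf, ht⟩

instance : (additiveSheaves hC).ContainsZero where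
  exists_zero := by
    obtain ⟨Z, hZ⟩ := HasZeroObject.zero (C := Sheaf (monoTopology hC) AddCommGrpCat.{u})
    refine ⟨Z, hZ, ⟨fun {X Y a b} => ?_⟩⟩
    have : IsZero ((opOp M ⋙ Z.obj).obj Y) :=
      (sheafToPresheaf _ _ ⋙ (evaluation _ _).obj (op (op Y))).map_isZero hZ
    exact this.eq_of_tgt _ _

instance : (additiveSheaves hC).IsClosedUnderFiniteProducts where
  isClosedUnderLimitsOfShape K _ := ⟨by
    rintro F ⟨p⟩
    refine ⟨fun {X Y a b} => ?_⟩
    let E : Sheaf (monoTopology hC) AddCommGrpCat.{u} ⥤ AddCommGrpCat.{u} :=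
      sheafToPresheaf _ _ ⋙ (evaluation _ _).obj (op (op Y))
    refine (isLimitOfPreserves E p.isLimit).hom_ext fun j => ?_
    have hj := p.prop_diag_obj j
    have h (c : X ⟶ Y) := (p.π.app j).hom.naturality c.op.op
    have hadd := hj.map_add (f := a) (g := b)
    have h₁ := h (a + b)
    dsimp [E] at h₁ hadd h ⊢
    rw [h₁, hadd, Preadditive.comp_add, Preadditive.add_comp, h a, h b]⟩

end Sheaves

/-! ### The abelian structure -/

section Abelian

variable {M : Type u} [SmallCategory M] [Preadditive M] (hC : HasMonoAmalgamation M)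

/-- The absolutely pure functors are the additive sheaves for the topology given by the
monomorphisms. -/
def toAdditiveSheaves : L2 M ⥤ (additiveSheaves hC).FullSubcategory :=
  (additiveSheaves hC).lift
    (ObjectProperty.lift _ ((absolutelyPure M).ι ⋙ (Functor.whiskeringLeft _ _ _).obj (unopUnop M))
      fun F => isSheaf_of_isAbsolutelyPure hC F.obj F.property)
    fun F => F.property.isMonoFunctor.additive

/-- The absolutely pure functor underlying an additive sheaf. -/
def ofAdditiveSheaves : (additiveSheaves hC).FullSubcategory ⥤ L2 M :=
  (absolutelyPure M).lift
    ((additiveSheaves hC).ι ⋙ sheafToPresheaf _ _ ⋙ (Functor.whiskeringLeft _ _ _).obj (opOp M))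
    fun F => isAbsolutelyPure_of_isSheaf hC _ F.property F.obj.property

/-- The category of absolutely pure functors is equivalent to the category of additive sheaves. -/
def equivAdditiveSheaves : L2 M ≌ (additiveSheaves hC).FullSubcategory where
  functor := toAdditiveSheaves hC
  inverse := ofAdditiveSheaves hC
  unitIso := Iso.refl _
  counitIso := Iso.refl _

/-- The category of absolutely pure functors is abelian. -/
noncomputable abbrev abelianL2 : Abelian (L2 M) :=
  have : (equivAdditiveSheaves hC).functor.IsEquivalence := inferInstance
  have : HasFiniteProducts (L2 M) :=
    ⟨fun _ => Adjunction.hasLimitsOfShape_of_equivalence (equivAdditiveSheaves hC).functor⟩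
  abelianOfEquivalence (equivAdditiveSheaves hC).functor

/-- A section of the kernel of `S.g` lifts objectwise through `S.f`, hence dies in the cokernel of
`S.f`, whatever that cokernel is objectwise. -/
lemma exact_of_app_exact (hC : HasMonoAmalgamation M) (S : ShortComplex (L2 M))
    (hS : ∀ X : M, Function.Exact (S.f.hom.app X) (S.g.hom.app X)) : S.Exact := by
  let _ := abelianL2 hC
  rw [S.exact_iff_kernel_ι_comp_cokernel_π_zero]
  ext X x
  have h : (kernel.ι S.g).hom.app X ≫ S.g.hom.app X = 0 :=
    congr(($(kernel.condition S.g)).hom.app X)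
  have h' : S.f.hom.app X ≫ (cokernel.π S.f).hom.app X = 0 :=
    congr(($(cokernel.condition S.f)).hom.app X)
  obtain ⟨y, hy⟩ := (hS X _).1 (congr($h x))
  exact (congr_arg ((cokernel.π S.f).hom.app X) hy.symm).trans (congr($h' y))

end Abelian

/-! ### Exactness of the representation functor -/

section Representation

variable {M : Type u} [SmallCategory M] [Preadditive M] {n : ℕ}
  (h : ∀ X : Mᵒᵖ, absolutelyPure M (preadditiveCoyoneda.obj X))

lemma preadditiveCoyoneda_app_eq {X : M} {F : M ⥤ AddCommGrpCat.{u}}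
    (c : preadditiveCoyoneda.obj (op X) ⟶ F) {Z : M} (z : X ⟶ Z) :
    c.app Z z = F.map z (c.app X (𝟙 X)) :=
  (congr_arg (c.app Z) (Category.id_comp z).symm).trans
    (NatTrans.naturality_apply c z (𝟙 X : X ⟶ X))

/-- By Yoneda a map `M(X, -) ⟶ F` is an element of `F X`, and its composite with `M(f, -)` is the
image of that element under the injective `F.map f`. Objectwise surjectivity is not needed. -/
lemma epi_representation_map {X Y : M} (f : X ⟶ Y) [Mono f] : Epi ((representation h).map f.op) where
  left_cancellation {F} a b hab := by
    have hF := (preservesMonomorphisms_iff _).1 F.property.isMonoFunctor.preservesMonomorphisms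
    have h₁ : a.hom.app X (𝟙 X) = b.hom.app X (𝟙 X) := by
      apply hF f inferInstance
      have hf (c : (representation h).obj (op X) ⟶ F) :
          F.obj.map f (c.hom.app X (𝟙 X)) = ((representation h).map f.op ≫ c).hom.app Y (𝟙 Y) :=
        (preadditiveCoyoneda_app_eq c.hom f).symm.trans
          (congr_arg (c.hom.app Y) (Category.comp_id f).symm)
      exact (hf a).trans (congr(($hab).hom.app Y (𝟙 Y)).trans (hf b).symm)
    ext Z z
    exact (preadditiveCoyoneda_app_eq a.hom z).trans
      ((congr_arg (F.obj.map z) h₁).trans (preadditiveCoyoneda_app_eq b.hom z).symm)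

lemma mono_representation_map {X Y : M} (f : X ⟶ Y)
    (hf : ∀ Z : M, Function.Injective fun u : Y ⟶ Z => f ≫ u) :
    Mono ((representation h).map f.op) where
  right_cancellation {F} a b hab := by
    ext Z z
    exact hf Z (congr(($hab).hom.app Z z))

lemma isContravariantNExact_representation (hC : HasMonoAmalgamation M) :
    IsContravariantNExact n (representation h) where
  mono X hX := mono_representation_map h _ hX.right.injective
  exact X hX k hk := by
    have w : X.map' k (k + 1) ≫ X.map' (k + 1) (k + 2) = 0 := by
      simpa using (hX.right.exact _ k hk (X.map' (k + 1) (k + 2))).2 ⟨𝟙 _, by simp⟩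
    refine ⟨?_, exact_of_app_exact hC _ fun Y => hX.right.exact Y k hk⟩
    rw [← Functor.map_comp, ← op_comp, w]
    ext Y y
    exact zero_comp
  epi X hX := by
    have : Mono (X.map' 0 1) := ⟨fun a b hab => hX.left.injective _ hab⟩
    exact epi_representation_map h _

end Representation

end NAb

theorem theorem4p3 (n : ℕ) (hn : 1 ≤ n) (M : Type u) [SmallCategory M] [Preadditive M]
    (hM : NAb.IsNAbelian n M) :
    Nonempty (Abelian (NAb.L2 M)) ∧
      ∃ h : ∀ X : Mᵒᵖ, NAb.absolutelyPure M (preadditiveCoyoneda.obj X),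
        NAb.IsContravariantNExact n (NAb.representation h) := by
  have hC := hM.hasMonoAmalgamation hn
  refine ⟨⟨NAb.abelianL2 hC⟩, fun X => ?_, ?_⟩
  · exact NAb.isAbsolutelyPure_preadditiveCoyoneda hC
      (fun A B f _ => hM.exists_mono_weakKernel hn f) X
  · exact NAb.isContravariantNExact_representation _ hC
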